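/- Let $\psi(x)=\frac{d}{dx}\ln\Gamma(x)$ denote the digamma function, let $\gamma$ denote the Euler–Mascheroni constant, and for real $a>0$ let $$S(a)=\sum_{k=1}^{\infty}\left[\ln\frac{k}{a}-\frac{a}{2k}-\psi\!\left(\frac{k}{a}\right)\right].$$ Let $m$ and $n$ be coprime positive integers. Then the series defining $S(n/m)$ converges absolutely, and $$S\!\left(\frac{n}{m}\right)=\frac{\ln(2\pi)-\gamma}{2}-\frac{1}{2m}-\frac12\ln\frac{m}{n}+\frac{\pi}{2n}\sum_{k=1}^{n-1}\left(\frac n2-k\right)\cot\frac{mk\pi}{n}+\frac{n\pi}{2m^2}\sum_{j=1}^{m-1}\left(\frac m2-j\right)\cot\frac{nj\pi}{m}.$$ -/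

import Mathlib

/-- The digamma function of a real variable, `ψ(x) = d/dx ln Γ(x)` (used for `x > 0`). -/
noncomputable def realDigamma (x : ℝ) : ℝ :=
  deriv (fun t : ℝ => Real.log (Real.Gamma t)) x

/-- On the positive axis this is Mathlib's complex digamma function. -/
theorem realDigamma_eq_digamma {x : ℝ} (hx : 0 < x) :
    ((realDigamma x : ℝ) : ℂ) = Complex.digamma (x : ℂ) := by
  have hne : ∀ m : ℕ, (x : ℂ) ≠ -(m : ℂ) := by
    intro m h
    have h1 : x = -(m : ℝ) := by exact_mod_cast h
    have h2 : (0 : ℝ) ≤ (m : ℝ) := Nat.cast_nonneg m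
    linarith
  have hc : HasDerivAt Complex.Gamma (deriv Complex.Gamma (x : ℂ)) (x : ℂ) :=
    (Complex.differentiableAt_Gamma (x : ℂ) hne).hasDerivAt
  have hr0 := hc.real_of_complex
  have hfun : (fun y : ℝ => (Complex.Gamma (y : ℂ)).re) = Real.Gamma := by
    funext y
    rw [Complex.Gamma_ofReal, Complex.ofReal_re]
  rw [hfun] at hr0
  have hcr : deriv Complex.Gamma (x : ℂ) = ((deriv Real.Gamma x : ℝ) : ℂ) := by
    have h1 : HasDerivAt (fun y : ℝ => Complex.Gamma (y : ℂ))
        (deriv Complex.Gamma (x : ℂ)) x := hc.comp_ofReal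
    have h2 : HasDerivAt (fun y : ℝ => Complex.Gamma (y : ℂ))
        ((deriv Real.Gamma x : ℝ) : ℂ) x := by
      have h3 := (hr0.differentiableAt.hasDerivAt).ofReal_comp
      have h4 : (fun y : ℝ => Complex.Gamma (y : ℂ)) =
          fun y : ℝ => ((Real.Gamma y : ℝ) : ℂ) := by
        funext y
        exact Complex.Gamma_ofReal y
      rw [h4]
      exact h3
    exact h1.unique h2
  have hd : realDigamma x = deriv Real.Gamma x / Real.Gamma x :=
    (hr0.differentiableAt.hasDerivAt.log (Real.Gamma_pos_of_pos hx).ne').deriv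
  rw [hd, Complex.digamma_def, logDeriv_apply, hcr, Complex.Gamma_ofReal, Complex.ofReal_div]

/-- The term `ln (k/a) - a/(2k) - ψ(k/a)` of the series that defines `S(a)`. -/
noncomputable def funcSTerm (a : ℝ) (k : ℕ) : ℝ :=
  Real.log ((k : ℝ) / a) - a / (2 * (k : ℝ)) - realDigamma ((k : ℝ) / a)

/-- `S(a) = ∑_{k ≥ 1} [ln (k/a) - a/(2k) - ψ(k/a)]` for `a > 0`. -/
noncomputable def funcS (a : ℝ) : ℝ := ∑' i : ℕ, funcSTerm a (i + 1)

/-! ### Recurrence and reflection for ψ. -/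

open Filter Topology Finset

/-! Gauss's multiplication formula (`sum_realDigamma_add_div`) rewrites ψ(mk/n) through the values
ψ(k/n + j/m), j < m. Summed over k ≤ Nn these telescope, because (x - 1)ψ(x) - x is an indefinite
sum of ψ. Stirling's formula, the harmonic asymptotics and ψ(x) = ln x - 1/(2x) + O(x⁻²) give the
limit N → ∞ (`funcS_div_eq`), leaving a finite sum of (c - 1)ψ(c) - c over the grid c = j/m + r/n.

That sum is elementary (`sum_sub_one_mul_realDigamma_sub`): the symmetry c ↦ 2 - c and the
reflection formula turn ψ into cot(πc), and the multiplication formula for cot (`sum_cot_add_div`)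
sums out one index. Coprimality keeps interior points away from the pole c = 1. -/

theorem realDigamma_add_one {x : ℝ} (hx : 0 < x) :
    realDigamma (x + 1) = realDigamma x + 1 / x := by
  have h := Complex.digamma_apply_add_one (x : ℂ) (fun m h => by
    have h1 : x = -(m : ℝ) := by exact_mod_cast h
    have h2 : (0 : ℝ) ≤ (m : ℝ) := Nat.cast_nonneg m
    linarith)
  rw [← realDigamma_eq_digamma hx] at h
  have h3 := realDigamma_eq_digamma (add_pos hx one_pos)
  push_cast at h3
  rw [← h3] at h
  rw [one_div]
  exact_mod_cast h

theorem realDigamma_one : realDigamma 1 = -Real.eulerMascheroniConstant := by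
  have h := realDigamma_eq_digamma one_pos
  rw [Complex.ofReal_one, Complex.digamma_one] at h
  exact_mod_cast h

theorem hasDerivAt_log_Gamma {x : ℝ} (hx : 0 < x) :
    HasDerivAt (fun t : ℝ => Real.log (Real.Gamma t)) (realDigamma x) x := by
  have hne : ∀ m : ℕ, x ≠ -(m : ℝ) := fun m h => by
    have h2 : (0 : ℝ) ≤ (m : ℝ) := Nat.cast_nonneg m
    linarith
  exact ((Real.differentiableAt_Gamma hne).log (Real.Gamma_pos_of_pos hx).ne').hasDerivAt

/-- Logarithmic derivative of Γ(x)Γ(1 - x) = π / sin(πx). -/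
theorem realDigamma_one_sub_sub_realDigamma {x : ℝ} (h0 : 0 < x) (h1 : x < 1) :
    realDigamma (1 - x) - realDigamma x = Real.pi * Real.cot (Real.pi * x) := by
  have hs : 0 < Real.sin (Real.pi * x) :=
    Real.sin_pos_of_pos_of_lt_pi (by positivity) (by nlinarith [Real.pi_pos])
  have hd1 := hasDerivAt_log_Gamma h0
  have hd2 : HasDerivAt (fun t : ℝ => Real.log (Real.Gamma (1 - t)))
      (realDigamma (1 - x) * (-1)) x :=
    (hasDerivAt_log_Gamma (sub_pos.2 h1)).comp x ((hasDerivAt_id x).const_sub 1)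
  have hd3 : HasDerivAt (fun t : ℝ => Real.log Real.pi - Real.log (Real.sin (Real.pi * t)))
      (-(Real.cos (Real.pi * x) * (Real.pi * 1) / Real.sin (Real.pi * x))) x :=
    ((((hasDerivAt_id x).const_mul Real.pi).sin).log hs.ne').const_sub _
  have he : (fun t : ℝ => Real.log Real.pi - Real.log (Real.sin (Real.pi * t))) =ᶠ[𝓝 x]
      fun t => Real.log (Real.Gamma t) + Real.log (Real.Gamma (1 - t)) := by
    filter_upwards [Ioo_mem_nhds h0 h1] with t ht
    have hst : 0 < Real.sin (Real.pi * t) :=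
      Real.sin_pos_of_pos_of_lt_pi (mul_pos Real.pi_pos ht.1) (by nlinarith [Real.pi_pos, ht.2])
    rw [← Real.log_mul (Real.Gamma_pos_of_pos ht.1).ne'
      (Real.Gamma_pos_of_pos (sub_pos.2 ht.2)).ne', Real.Gamma_mul_Gamma_one_sub,
      Real.log_div Real.pi_ne_zero hst.ne']
  have := (hd1.add hd2).unique (hd3.congr_of_eventuallyEq he.symm)
  rw [Real.cot_eq_cos_div_sin]
  linear_combination -this

/-! ### Bounds for ψ. -/

theorem log_Gamma_add_one {x : ℝ} (hx : 0 < x) :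
    Real.log (Real.Gamma (x + 1)) = Real.log x + Real.log (Real.Gamma x) := by
  rw [Real.Gamma_add_one hx.ne', Real.log_mul hx.ne' (Real.Gamma_pos_of_pos hx).ne']

/-- By convexity of ln Γ, its slope over [x, x + 1], which is ln x, lies between ψ(x) and ψ(x + 1);
the next lemma is the other half. -/
theorem realDigamma_le_log {x : ℝ} (hx : 0 < x) : realDigamma x ≤ Real.log x := by
  have h := Real.convexOn_log_Gamma.deriv_le_slope (x := x) (y := x + 1) hx
    (show (0 : ℝ) < x + 1 by linarith) (by linarith) (hasDerivAt_log_Gamma hx).differentiableAt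
  rw [slope_def_field] at h
  simp only [Function.comp_apply, log_Gamma_add_one hx] at h
  rwa [add_sub_cancel_left, div_one, add_sub_cancel_right] at h

theorem log_le_realDigamma_add {x : ℝ} (hx : 0 < x) :
    Real.log x ≤ realDigamma x + 1 / x := by
  have hx1 : 0 < x + 1 := by linarith
  have h := Real.convexOn_log_Gamma.slope_le_deriv (x := x) (y := x + 1) hx
    hx1 (by linarith) (hasDerivAt_log_Gamma hx1).differentiableAt
  rw [slope_def_field] at h
  simp only [Function.comp_apply, log_Gamma_add_one hx] at h
  rw [← realDigamma_add_one hx]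
  rwa [add_sub_cancel_left, div_one, add_sub_cancel_right] at h

theorem tendsto_log_sub_realDigamma :
    Tendsto (fun x => Real.log x - realDigamma x) atTop (𝓝 0) := by
  refine squeeze_zero' ?_ ?_ (g := fun x => 1 / x) ?_
  · filter_upwards [eventually_gt_atTop 0] with x hx using sub_nonneg.2 (realDigamma_le_log hx)
  · filter_upwards [eventually_gt_atTop 0] with x hx
    linarith [log_le_realDigamma_add hx]
  · simpa using tendsto_inv_atTop_zero (𝕜 := ℝ)

/-- F(x) dominates F(x + N), which tends to 0. This reduces estimates for ψ to its difference
equation. -/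
theorem nonneg_of_add_one_le_of_tendsto_zero {F : ℝ → ℝ}
    (h : ∀ x, 0 < x → F (x + 1) ≤ F x) (hF : Tendsto F atTop (𝓝 0)) {x : ℝ} (hx : 0 < x) :
    0 ≤ F x := by
  have hle : ∀ N : ℕ, F (x + N) ≤ F x := by
    intro N
    induction N with
    | zero => simp
    | succ N ih =>
      have := h (x + N) (by positivity)
      rw [Nat.cast_succ, ← add_assoc]
      exact this.trans ih
  exact le_of_tendsto' (hF.comp (tendsto_const_nhds.add_atTop tendsto_natCast_atTop_atTop)) hle

theorem log_add_one_sub_log {x : ℝ} (hx : 0 < x) :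
    Real.log (x + 1) - Real.log x = Real.log (1 + 1 / x) := by
  rw [← Real.log_div (by positivity) hx.ne']
  congr 1
  field_simp

/-- The remainder of the two-term asymptotic expansion of the digamma function. -/
noncomputable def digammaRemainder (x : ℝ) : ℝ :=
  Real.log x - 1 / (2 * x) - realDigamma x

theorem digammaRemainder_sub {x : ℝ} (hx : 0 < x) :
    digammaRemainder x - digammaRemainder (x + 1) =
      (1 / x + 1 / (x + 1)) / 2 - Real.log (1 + 1 / x) := by
  unfold digammaRemainder
  rw [realDigamma_add_one hx, ← log_add_one_sub_log hx]
  field_simp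
  ring

theorem tendsto_digammaRemainder : Tendsto digammaRemainder atTop (𝓝 0) := by
  have h := tendsto_log_sub_realDigamma.sub
    ((tendsto_inv_atTop_zero (𝕜 := ℝ)).const_mul (1 / 2))
  rw [mul_zero, sub_zero] at h
  refine h.congr fun x => ?_
  unfold digammaRemainder
  rw [one_div (2 * x), mul_inv]
  ring

theorem digammaRemainder_nonneg {x : ℝ} (hx : 0 < x) : 0 ≤ digammaRemainder x := by
  refine nonneg_of_add_one_le_of_tendsto_zero (fun y hy => ?_) tendsto_digammaRemainder hx
  rw [← sub_nonneg, digammaRemainder_sub hy]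
  have hy1 : 0 < 1 + 1 / y := by positivity
  -- For t = ln(1 + 1/y), sinh t is exactly the trapezoidal mean of 1/y and 1/(y + 1), so t ≤ sinh t
  -- is the required inequality.
  have h := Real.self_le_sinh_iff.2 (Real.log_nonneg (show 1 ≤ 1 + 1 / y by
    have : 0 < 1 / y := by positivity
    linarith))
  rw [Real.sinh_log hy1] at h
  have he : (1 + 1 / y - (1 + 1 / y)⁻¹) / 2 = (1 / y + 1 / (y + 1)) / 2 := by
    field_simp
    ring
  linarith

theorem digammaRemainder_le {x : ℝ} (hx : 0 < x) : digammaRemainder x ≤ 1 / (8 * x ^ 2) := by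
  have hlim : Tendsto (fun y : ℝ => 1 / (8 * y ^ 2)) atTop (𝓝 0) := by
    have := ((tendsto_inv_atTop_zero (𝕜 := ℝ)).pow 2).const_mul (1 / 8)
    simp only [ne_eq, OfNat.ofNat_ne_zero, not_false_eq_true, zero_pow, mul_zero] at this
    refine this.congr fun y => ?_
    rw [one_div (8 * y ^ 2), mul_inv, inv_pow]
    ring
  have h := hlim.sub tendsto_digammaRemainder
  rw [sub_zero] at h
  refine sub_nonneg.1 (nonneg_of_add_one_le_of_tendsto_zero (fun y hy => ?_) h hx)
  have h1 := digammaRemainder_sub hy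
  -- The bound ln(1 + u) ≥ 2u/(u + 2) makes the comparison rational; with 1/8 the difference is an
  -- explicit positive fraction. Later only the order x⁻² matters.
  have h2 := Real.le_log_one_add_of_nonneg (x := 1 / y) (by positivity)
  have h3 : (1 / y + 1 / (y + 1)) / 2 - 2 * (1 / y) / (1 / y + 2) ≤
      1 / (8 * y ^ 2) - 1 / (8 * (y + 1) ^ 2) := by
    have : 1 / (8 * y ^ 2) - 1 / (8 * (y + 1) ^ 2) -
        ((1 / y + 1 / (y + 1)) / 2 - 2 * (1 / y) / (1 / y + 2)) =
        1 / (8 * y ^ 2 * (y + 1) ^ 2 * (2 * y + 1)) := by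
      have h4 : 1 / y + 2 = (2 * y + 1) / y := by
        field_simp
        ring
      rw [h4]
      field_simp
      ring
    have h5 : 0 ≤ 1 / (8 * y ^ 2 * (y + 1) ^ 2 * (2 * y + 1)) := by positivity
    linarith
  linarith

/-! ### Multiplication formulas for ψ and cot. -/

theorem realDigamma_add_natCast {x : ℝ} (hx : 0 < x) (N : ℕ) :
    realDigamma (x + N) = realDigamma x + ∑ i ∈ range N, 1 / (x + i) := by
  induction N with
  | zero => simp
  | succ N ih =>
    rw [sum_range_succ, Nat.cast_succ, ← add_assoc, realDigamma_add_one (by positivity), ih]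
    ring

/-- Gauss's multiplication formula for the digamma function. -/
theorem sum_realDigamma_add_div {m : ℕ} (hm : 0 < m) {x : ℝ} (hx : 0 < x) :
    ∑ j ∈ range m, realDigamma (x + j / m) = m * (realDigamma (m * x) - Real.log m) := by
  have hm' : (0 : ℝ) < m := Nat.cast_pos.2 hm
  set F : ℝ → ℝ := fun x =>
    ∑ j ∈ range m, realDigamma (x + j / m) - m * (realDigamma (m * x) - Real.log m) with hF
  -- The defect `F` has period 1 and tends to 0 at infinity, hence vanishes.
  have hstep : ∀ y, 0 < y → F (y + 1) = F y := by
    intro y hy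
    have h1 : ∀ j ∈ range m, realDigamma (y + 1 + j / m) =
        realDigamma (y + j / m) + m * (1 / (m * y + j)) := by
      intro j _
      rw [add_right_comm, realDigamma_add_one (by positivity)]
      congr 1
      field_simp
    simp only [hF]
    rw [sum_congr rfl h1, sum_add_distrib, ← mul_sum, mul_add, mul_one,
      realDigamma_add_natCast (by positivity)]
    ring
  have hlim : Tendsto F atTop (𝓝 0) := by
    have h1 : ∀ j ∈ range m, Tendsto (fun y : ℝ =>
        Real.log (1 + (j / m : ℝ) / y) -
          (Real.log (y + j / m) - realDigamma (y + j / m))) atTop (𝓝 0) := by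
      intro j _
      have ha : Tendsto (fun y : ℝ => Real.log (1 + (j / m : ℝ) / y)) atTop (𝓝 0) := by
        have h2 : Tendsto (fun y : ℝ => 1 + (j / m : ℝ) / y) atTop (𝓝 (1 + 0)) :=
          (tendsto_const_nhds.div_atTop tendsto_id).const_add 1
        have h3 := h2.log (by norm_num)
        simpa using h3
      have hb := tendsto_log_sub_realDigamma.comp
        (tendsto_atTop_add_const_right atTop (j / m : ℝ) tendsto_id)
      simpa using ha.sub hb
    have h2 := (tendsto_log_sub_realDigamma.comp
      (tendsto_id.const_mul_atTop hm')).const_mul (m : ℝ)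
    have h3 := (tendsto_finsetSum _ h1).add h2
    simp only [sum_const_zero, mul_zero, add_zero] at h3
    refine h3.congr' ?_
    filter_upwards [eventually_gt_atTop 0] with y hy
    have h4 : ∀ j ∈ range m, Real.log (1 + (j / m : ℝ) / y) -
        (Real.log (y + j / m) - realDigamma (y + j / m)) =
        realDigamma (y + j / m) - Real.log y := by
      intro j _
      have : 1 + (j / m : ℝ) / y = (y + j / m) / y := by field_simp
      rw [this, Real.log_div (by positivity) hy.ne']
      ring
    simp only [hF, Function.comp_apply, id_eq]
    rw [sum_congr rfl h4, sum_sub_distrib, sum_const, card_range, nsmul_eq_mul,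
      Real.log_mul hm'.ne' hy.ne']
    ring
  have h1 := nonneg_of_add_one_le_of_tendsto_zero (fun y hy => (hstep y hy).le) hlim hx
  have h2 := nonneg_of_add_one_le_of_tendsto_zero (F := fun y => -F y)
    (fun y hy => by rw [hstep y hy]) (by simpa using hlim.neg) hx
  have h3 : F x = 0 := by linarith
  exact sub_eq_zero.1 h3

theorem sum_Ico_one_reflect (f : ℕ → ℝ) (m : ℕ) :
    ∑ j ∈ Ico 1 m, f (m - j) = ∑ j ∈ Ico 1 m, f j := by
  have h := sum_Ico_reflect f 1 (Nat.le_succ m)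
  simpa using h

theorem sum_range_succ_eq_sum_Ico_one_add (f : ℕ → ℝ) {m : ℕ} (hm : 0 < m) :
    ∑ j ∈ range m, f (j + 1) = ∑ j ∈ Ico 1 m, f j + f m := by
  rw [← sum_Ico_succ_top hm, sum_Ico_eq_sum_range]
  simp [add_comm]

theorem sum_range_eq_add_sum_Ico_one (f : ℕ → ℝ) {m : ℕ} (hm : 0 < m) :
    ∑ j ∈ range m, f j = f 0 + ∑ j ∈ Ico 1 m, f j := by
  rw [range_eq_Ico, sum_eq_sum_Ico_succ_bot hm]

theorem cot_add_pi (x : ℝ) : Real.cot (x + Real.pi) = Real.cot x := by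
  rw [Real.cot_eq_cos_div_sin, Real.cot_eq_cos_div_sin, Real.cos_add_pi, Real.sin_add_pi,
    neg_div_neg_eq]

theorem cot_neg (x : ℝ) : Real.cot (-x) = -Real.cot x := by
  rw [Real.cot_eq_cos_div_sin, Real.cot_eq_cos_div_sin, Real.cos_neg, Real.sin_neg, div_neg]

/-- Subtract Gauss's formula at x from the one at 1/n - x. With one sum reversed, the arguments pair
as t and 1 - t, and reflection yields π cot(πt). -/
theorem sum_cot_add_div_of_lt {n : ℕ} (hn : 0 < n) {x : ℝ} (h0 : 0 < x) (h1 : n * x < 1) :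
    ∑ r ∈ range n, Real.cot (Real.pi * (x + r / n)) = n * Real.cot (Real.pi * (n * x)) := by
  have hn' : (0 : ℝ) < n := Nat.cast_pos.2 hn
  have hx : 0 < 1 / n - x := by
    rw [sub_pos, lt_div_iff₀ hn', mul_comm]
    exact h1
  have e1 := sum_realDigamma_add_div hn h0
  have e2 := sum_realDigamma_add_div hn hx
  rw [← sum_range_reflect] at e2
  have e3 := realDigamma_one_sub_sub_realDigamma (mul_pos hn' h0) h1
  have e4 : ∀ r ∈ range n, Real.pi * Real.cot (Real.pi * (x + r / n)) =
      realDigamma (1 / n - x + (n - 1 - r : ℕ) / n) - realDigamma (x + r / n) := by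
    intro r hr
    have hr' : r + 1 ≤ n := Nat.succ_le_of_lt (mem_range.1 hr)
    have hr'' : (r : ℝ) + 1 ≤ n := by exact_mod_cast hr'
    have hlt : x + r / n < 1 := by
      have : (r : ℝ) / n ≤ 1 - 1 / n := by
        rw [div_le_iff₀ hn']
        field_simp
        linarith
      linarith
    rw [← realDigamma_one_sub_sub_realDigamma (by positivity) hlt]
    congr 2
    rw [Nat.sub_sub, Nat.cast_sub (by omega)]
    push_cast
    field_simp
    ring
  have e5 := sum_congr rfl e4
  rw [sum_sub_distrib, e1, e2, ← mul_sum] at e5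
  have e6 : (n : ℝ) * (1 / n - x) = 1 - n * x := by field_simp
  rw [e6] at e5
  refine mul_left_cancel₀ Real.pi_ne_zero ?_
  linear_combination e5 + n * e3

theorem sum_cot_add_div {n : ℕ} (hn : 0 < n) {x : ℝ} (hx : ∀ k : ℤ, (n : ℝ) * x ≠ k) :
    ∑ r ∈ range n, Real.cot (Real.pi * (x + r / n)) = n * Real.cot (Real.pi * (n * x)) := by
  have hn' : (0 : ℝ) < n := Nat.cast_pos.2 hn
  set F : ℝ → ℝ := fun y =>
    ∑ r ∈ range n, Real.cot (Real.pi * (y + r / n)) - n * Real.cot (Real.pi * (n * y)) with hF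
  -- A shift by 1/n permutes the summands cyclically, so x may be reduced to 0 < nx < 1.
  have hper : Function.Periodic F (1 / n) := by
    intro y
    have h1 := sum_range_succ_eq_sum_Ico_one_add
      (fun r : ℕ => Real.cot (Real.pi * (y + r / n))) hn
    have h2 := sum_range_eq_add_sum_Ico_one
      (fun r : ℕ => Real.cot (Real.pi * (y + r / n))) hn
    have h3 : Real.cot (Real.pi * (y + (n : ℝ) / n)) = Real.cot (Real.pi * (y + (0 : ℕ) / n)) := by
      rw [div_self hn'.ne', mul_add, mul_one, cot_add_pi]
      simp
    have h4 : Real.cot (Real.pi * (n * (y + 1 / n))) = Real.cot (Real.pi * (n * y)) := by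
      rw [← cot_add_pi (Real.pi * (n * y))]
      congr 1
      field_simp
    have h5 : ∀ r ∈ range n, Real.cot (Real.pi * (y + 1 / n + r / n)) =
        Real.cot (Real.pi * (y + (r + 1 : ℕ) / n)) := by
      intro r _
      congr 2
      push_cast
      ring
    simp only [hF]
    rw [h4, sum_congr rfl h5, h1, h2, h3]
    ring
  have hfr : 0 < Int.fract ((n : ℝ) * x) :=
    (Int.fract_nonneg _).lt_of_ne fun h => hx ⌊(n : ℝ) * x⌋ (by
      have := Int.floor_add_fract ((n : ℝ) * x)
      linarith)
  have h1 := hper.sub_int_mul_eq (x := x) ⌊(n : ℝ) * x⌋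
  have h2 : x - ⌊(n : ℝ) * x⌋ * (1 / n) = Int.fract ((n : ℝ) * x) / n := by
    rw [Int.fract]
    field_simp
  have h3 : (n : ℝ) * (Int.fract ((n : ℝ) * x) / n) = Int.fract ((n : ℝ) * x) := by
    field_simp
  have h4 : F (Int.fract ((n : ℝ) * x) / n) = 0 :=
    sub_eq_zero.2 (sum_cot_add_div_of_lt hn (by positivity) (h3.trans_lt (Int.fract_lt_one _)))
  rw [← h2, h1] at h4
  exact sub_eq_zero.1 h4

/-! ### Finite sums of ψ at rational points. -/

theorem sum_realDigamma_div {m : ℕ} (hm : 0 < m) :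
    ∑ j ∈ Ico 1 m, realDigamma (j / m) =
      -((m - 1) * Real.eulerMascheroniConstant) - m * Real.log m := by
  have hm' : (0 : ℝ) < m := Nat.cast_pos.2 hm
  have h := sum_realDigamma_add_div hm (x := 1 / m) (by positivity)
  have h1 := sum_range_succ_eq_sum_Ico_one_add (fun j : ℕ => realDigamma (j / m)) hm
  have h2 : ∀ j ∈ range m, realDigamma (1 / m + j / m) = realDigamma ((j + 1 : ℕ) / m) := by
    intro j _
    congr 1
    push_cast
    ring
  rw [sum_congr rfl h2, h1, mul_one_div_cancel hm'.ne', div_self hm'.ne', realDigamma_one] at h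
  linear_combination h

/-- The weight is odd under j ↦ m - j, so pairing leaves only reflection differences. -/
theorem sum_sub_half_mul_realDigamma (m : ℕ) :
    ∑ j ∈ Ico 1 m, ((j : ℝ) / m - 1 / 2) * realDigamma (j / m) =
      -(Real.pi / 2 * ∑ j ∈ Ico 1 m, ((j : ℝ) / m - 1 / 2) * Real.cot (Real.pi * (j / m))) := by
  have h := sum_Ico_one_reflect (fun j : ℕ => ((j : ℝ) / m - 1 / 2) * realDigamma (j / m)) m
  have h1 : ∀ j ∈ Ico 1 m, (((m - j : ℕ) : ℝ) / m - 1 / 2) * realDigamma ((m - j : ℕ) / m) =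
      -(((j : ℝ) / m - 1 / 2) * realDigamma (j / m)) -
        Real.pi * (((j : ℝ) / m - 1 / 2) * Real.cot (Real.pi * (j / m))) := by
    intro j hj
    obtain ⟨hj1, hjm⟩ := mem_Ico.1 hj
    have hj1' : (0 : ℝ) < j := Nat.cast_pos.2 hj1
    have hjm' : (j : ℝ) < m := Nat.cast_lt.2 hjm
    have hm' : (0 : ℝ) < m := hj1'.trans hjm'
    have e := realDigamma_one_sub_sub_realDigamma (x := (j : ℝ) / m) (by positivity)
      ((div_lt_one hm').2 hjm')
    rw [Nat.cast_sub hjm.le, sub_div, div_self hm'.ne']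
    linear_combination (1 / 2 - (j : ℝ) / m) * e
  rw [sum_congr rfl h1, sum_sub_distrib, sum_neg_distrib, ← mul_sum] at h
  linear_combination -h / 2

theorem sub_one_mul_realDigamma_add_of_lt {c : ℝ} (h0 : 0 < c) (h1 : c < 1) :
    (c - 1) * realDigamma c + (1 - c) * realDigamma (2 - c) =
      1 - Real.pi * ((c - 1) * Real.cot (Real.pi * c)) := by
  have e1 := realDigamma_one_sub_sub_realDigamma h0 h1
  have e2 := realDigamma_add_one (sub_pos.2 h1)
  have e3 : (1 - c) * (1 / (1 - c)) = 1 := mul_one_div_cancel (sub_pos.2 h1).ne'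
  rw [show (2 : ℝ) - c = 1 - c + 1 by ring, e2]
  linear_combination (1 - c) * e1 + e3

theorem sub_one_mul_realDigamma_add {c : ℝ} (h0 : 0 < c) (h2 : c < 2) (h1 : c ≠ 1) :
    (c - 1) * realDigamma c + (1 - c) * realDigamma (2 - c) =
      1 - Real.pi * ((c - 1) * Real.cot (Real.pi * c)) := by
  rcases h1.lt_or_gt with h | h
  · exact sub_one_mul_realDigamma_add_of_lt h0 h
  · have e := sub_one_mul_realDigamma_add_of_lt (c := 2 - c) (by linarith) (by linarith)
    have e1 : Real.cot (Real.pi * (2 - c)) = -Real.cot (Real.pi * c) := by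
      rw [← cot_neg, ← cot_add_pi (-(Real.pi * c)), ← cot_add_pi (-(Real.pi * c) + _)]
      congr 1
      ring
    rw [e1, sub_sub_cancel] at e
    linear_combination e

section Coprime

variable {m n : ℕ}

theorem mul_div_ne_intCast (hmn : Nat.Coprime m n) {j : ℕ} (hj : j ∈ Ico 1 m) (k : ℤ) :
    (n : ℝ) * (j / m) ≠ k := by
  obtain ⟨hj1, hjm⟩ := mem_Ico.1 hj
  intro h
  have hm' : (m : ℝ) ≠ 0 := Nat.cast_ne_zero.2 (by omega)
  have h1 : ((n * j : ℕ) : ℤ) = k * m := by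
    field_simp at h
    have h' : ((n : ℝ) * j) = k * m := by linarith
    exact_mod_cast h'
  have h2 : (m : ℤ) ∣ ((n * j : ℕ) : ℤ) := ⟨k, by rw [h1, mul_comm]⟩
  have h3 : m ∣ j := hmn.dvd_of_dvd_mul_left (Int.natCast_dvd_natCast.1 h2)
  exact absurd (Nat.le_of_dvd hj1 h3) (by omega)

theorem sum_Ico_cot_add_div (hn : 0 < n) (hmn : Nat.Coprime m n) {j : ℕ} (hj : j ∈ Ico 1 m) :
    ∑ r ∈ Ico 1 n, Real.cot (Real.pi * (j / m + r / n)) =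
      n * Real.cot (Real.pi * (n * (j / m))) - Real.cot (Real.pi * (j / m)) := by
  have h := sum_cot_add_div hn (mul_div_ne_intCast hmn hj)
  rw [sum_range_eq_add_sum_Ico_one _ hn] at h
  simp only [Nat.cast_zero, zero_div, add_zero] at h
  linear_combination h

theorem div_add_div_ne_one (hmn : Nat.Coprime m n) {j r : ℕ} (hj : j ∈ Ico 1 m)
    (hn : 0 < n) : (j : ℝ) / m + r / n ≠ 1 := by
  intro h
  have hn' : (n : ℝ) ≠ 0 := Nat.cast_ne_zero.2 hn.ne'
  refine mul_div_ne_intCast hmn hj ((n : ℤ) - r) ?_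
  have : (j : ℝ) / m = 1 - r / n := by linarith
  rw [this]
  push_cast
  field_simp

/-- The terms with `0 < j < m` and `0 < r < n` of the sum of `(c - 1) ψ(c)` over
`c = j / m + r / n`. -/
theorem sum_interior (hm : 0 < m) (hn : 0 < n) (hmn : Nat.Coprime m n) :
    ∑ j ∈ Ico 1 m, ∑ r ∈ Ico 1 n,
        ((j : ℝ) / m + r / n - 1) * realDigamma (j / m + r / n) =
      (m - 1) * (n - 1) / 2 - Real.pi / 2 *
        (∑ j ∈ Ico 1 m, ((j : ℝ) / m - 1 / 2) *
            (n * Real.cot (Real.pi * (n * (j / m))) - Real.cot (Real.pi * (j / m))) +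
          ∑ r ∈ Ico 1 n, ((r : ℝ) / n - 1 / 2) *
            (m * Real.cot (Real.pi * (m * (r / n))) - Real.cot (Real.pi * (r / n)))) := by
  set f : ℕ → ℕ → ℝ := fun j r =>
    ((j : ℝ) / m + r / n - 1) * realDigamma (j / m + r / n) with hf
  have hrefl : ∑ j ∈ Ico 1 m, ∑ r ∈ Ico 1 n, f (m - j) (n - r) =
      ∑ j ∈ Ico 1 m, ∑ r ∈ Ico 1 n, f j r := by
    rw [← sum_Ico_one_reflect (fun j => ∑ r ∈ Ico 1 n, f j r) m]
    exact sum_congr rfl fun j _ => sum_Ico_one_reflect (fun r => f (m - j) r) n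
  -- Here c ↦ 2 - c; splitting c - 1 as (j/m - 1/2) + (r/n - 1/2) lets each cotangent sum be taken
  -- over the index absent from its weight.
  have hpair : ∀ j ∈ Ico 1 m, ∀ r ∈ Ico 1 n, f j r + f (m - j) (n - r) =
      1 - Real.pi * (((j : ℝ) / m - 1 / 2) * Real.cot (Real.pi * (j / m + r / n)) +
        ((r : ℝ) / n - 1 / 2) * Real.cot (Real.pi * (r / n + j / m))) := by
    intro j hj r hr
    have hne := div_add_div_ne_one hmn hj hn (r := r)
    obtain ⟨hj1, hjm⟩ := mem_Ico.1 hj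
    obtain ⟨hr1, hrn⟩ := mem_Ico.1 hr
    have hj1' : (0 : ℝ) < j := Nat.cast_pos.2 hj1
    have hm' : (0 : ℝ) < m := Nat.cast_pos.2 hm
    have hn' : (0 : ℝ) < n := Nat.cast_pos.2 hn
    have hjm' : (j : ℝ) / m < 1 := (div_lt_one hm').2 (Nat.cast_lt.2 hjm)
    have hrn' : (r : ℝ) / n < 1 := (div_lt_one hn').2 (Nat.cast_lt.2 hrn)
    have e := sub_one_mul_realDigamma_add (c := (j : ℝ) / m + r / n) (by positivity)
      (by linarith) hne
    simp only [hf]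
    rw [Nat.cast_sub hjm.le, Nat.cast_sub hrn.le, sub_div, sub_div, div_self hm'.ne',
      div_self hn'.ne', add_comm ((r : ℝ) / n) (j / m),
      show (1 : ℝ) - j / m + (1 - r / n) = 2 - (j / m + r / n) by ring]
    linear_combination e
  have h2 : ∑ j ∈ Ico 1 m, ∑ r ∈ Ico 1 n, (f j r + f (m - j) (n - r)) =
      (m - 1) * (n - 1) - Real.pi *
        (∑ j ∈ Ico 1 m, ((j : ℝ) / m - 1 / 2) *
            (n * Real.cot (Real.pi * (n * (j / m))) - Real.cot (Real.pi * (j / m))) +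
          ∑ r ∈ Ico 1 n, ((r : ℝ) / n - 1 / 2) *
            (m * Real.cot (Real.pi * (m * (r / n))) - Real.cot (Real.pi * (r / n)))) := by
    rw [sum_congr rfl fun j hj => sum_congr rfl (hpair j hj)]
    simp only [sum_sub_distrib, ← mul_sum, sum_add_distrib]
    rw [sum_comm (s := Ico 1 m) (t := Ico 1 n)
      (f := fun j r => ((r : ℝ) / n - 1 / 2) * Real.cot (Real.pi * (r / n + j / m)))]
    simp only [← mul_sum]
    have ha : ∀ j ∈ Ico 1 m, ((j : ℝ) / m - 1 / 2) *
        ∑ r ∈ Ico 1 n, Real.cot (Real.pi * (j / m + r / n)) = ((j : ℝ) / m - 1 / 2) *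
          (n * Real.cot (Real.pi * (n * (j / m))) - Real.cot (Real.pi * (j / m))) :=
      fun j hj => by rw [sum_Ico_cot_add_div hn hmn hj]
    have hb : ∀ r ∈ Ico 1 n, ((r : ℝ) / n - 1 / 2) *
        ∑ j ∈ Ico 1 m, Real.cot (Real.pi * (r / n + j / m)) = ((r : ℝ) / n - 1 / 2) *
          (m * Real.cot (Real.pi * (m * (r / n))) - Real.cot (Real.pi * (r / n))) :=
      fun r hr => by rw [sum_Ico_cot_add_div hm hmn.symm hr]
    rw [sum_congr rfl ha, sum_congr rfl hb]
    simp only [sum_const, Nat.card_Ico, nsmul_eq_mul, mul_one, Nat.cast_sub (Nat.succ_le_of_lt hm),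
      Nat.cast_sub (Nat.succ_le_of_lt hn), Nat.cast_one]
  have h3 : ∑ j ∈ Ico 1 m, ∑ r ∈ Ico 1 n, (f j r + f (m - j) (n - r)) =
      2 * ∑ j ∈ Ico 1 m, ∑ r ∈ Ico 1 n, f j r := by
    simp only [sum_add_distrib]
    rw [hrefl]
    ring
  linear_combination (h2 - h3) / 2

theorem sum_div_add_succ_div (hm : 0 < m) (hn : 0 < n) :
    ∑ j ∈ range m, ∑ r ∈ range n, ((j : ℝ) / m + (r + 1 : ℕ) / n) =
      ((m : ℝ) - n) / 2 + m * n := by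
  have hm' : (0 : ℝ) < m := Nat.cast_pos.2 hm
  have hn' : (0 : ℝ) < n := Nat.cast_pos.2 hn
  have hs : ∀ N : ℕ, ∑ i ∈ range N, (i : ℝ) = N * (N - 1) / 2 := by
    intro N
    induction N with
    | zero => simp
    | succ N ih =>
      rw [sum_range_succ, ih]
      push_cast
      ring
  simp only [Nat.cast_add, Nat.cast_one, sum_add_distrib, sum_const, card_range, nsmul_eq_mul,
    ← mul_sum, ← sum_div, hs]
  field_simp
  ring

/-- The grid splits into the corner c = 1 (weight zero), two edges and the interior. The edges
supply γ and the logarithms, and their cotangent sums cancel the single-angle ones of the interior.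
-/
theorem sum_sub_one_mul_realDigamma_sub (hm : 0 < m) (hn : 0 < n) (hmn : Nat.Coprime m n) :
    ∑ j ∈ range m, ∑ r ∈ range n,
        (((j : ℝ) / m + (r + 1 : ℕ) / n - 1) * realDigamma (j / m + (r + 1 : ℕ) / n) -
          (j / m + (r + 1 : ℕ) / n)) =
      (((n : ℝ) - m) * Real.eulerMascheroniConstant + n * Real.log n - m * Real.log m
          - m * n - 1) / 2 - Real.pi / 2 *
        (n * ∑ j ∈ Ico 1 m, ((j : ℝ) / m - 1 / 2) * Real.cot (Real.pi * (n * (j / m))) +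
          m * ∑ r ∈ Ico 1 n, ((r : ℝ) / n - 1 / 2) * Real.cot (Real.pi * (m * (r / n)))) := by
  have hm' : (0 : ℝ) < m := Nat.cast_pos.2 hm
  have hn' : (0 : ℝ) < n := Nat.cast_pos.2 hn
  set f : ℕ → ℕ → ℝ := fun j r =>
    ((j : ℝ) / m + r / n - 1) * realDigamma (j / m + r / n) with hf
  have h0 : ∑ j ∈ range m, ∑ r ∈ range n, f j (r + 1) =
      ∑ r ∈ Ico 1 n, f 0 r + ∑ j ∈ Ico 1 m, f j n + ∑ j ∈ Ico 1 m, ∑ r ∈ Ico 1 n, f j r := by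
    rw [sum_congr rfl fun j _ => sum_range_succ_eq_sum_Ico_one_add (f j) hn,
      sum_range_eq_add_sum_Ico_one _ hm, sum_add_distrib]
    have : f 0 n = 0 := by
      simp [hf, hn'.ne']
    rw [this]
    ring
  have h1 : ∑ r ∈ Ico 1 n, f 0 r =
      ∑ r ∈ Ico 1 n, ((r : ℝ) / n - 1 / 2) * realDigamma (r / n) -
        1 / 2 * ∑ r ∈ Ico 1 n, realDigamma (r / n) := by
    rw [mul_sum, ← sum_sub_distrib]
    refine sum_congr rfl fun r _ => ?_
    simp only [hf, Nat.cast_zero, zero_div, zero_add]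
    ring
  have h2 : ∑ j ∈ Ico 1 m, f j n =
      ∑ j ∈ Ico 1 m, ((j : ℝ) / m - 1 / 2) * realDigamma (j / m) +
        1 / 2 * ∑ j ∈ Ico 1 m, realDigamma (j / m) + (m - 1) := by
    have : ((m : ℝ) - 1) = ∑ j ∈ Ico 1 m, (1 : ℝ) := by
      simp [Nat.cast_sub, Nat.succ_le_of_lt hm]
    rw [this, mul_sum, ← sum_add_distrib, ← sum_add_distrib]
    refine sum_congr rfl fun j hj => ?_
    have hj' : (0 : ℝ) < j := Nat.cast_pos.2 (mem_Ico.1 hj).1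
    simp only [hf, div_self hn'.ne']
    rw [realDigamma_add_one (by positivity)]
    field_simp
    ring
  rw [sum_realDigamma_div hn, sum_sub_half_mul_realDigamma] at h1
  rw [sum_realDigamma_div hm, sum_sub_half_mul_realDigamma] at h2
  have h3 := sum_interior hm hn hmn
  simp only [mul_sub, sum_sub_distrib, mul_left_comm _ (n : ℝ) (Real.cot _),
    mul_left_comm _ (m : ℝ) (Real.cot _), ← mul_sum] at h3
  have h4 := sum_div_add_succ_div hm hn
  simp only [sum_sub_distrib]
  rw [h4]
  linear_combination h0 + h1 + h2 + h3

end Coprime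

/-- An indefinite sum of the digamma function. -/
noncomputable def digammaSum (x : ℝ) : ℝ := (x - 1) * realDigamma x - x

theorem digammaSum_add_one {x : ℝ} (hx : 0 < x) :
    digammaSum (x + 1) = digammaSum x + realDigamma x := by
  unfold digammaSum
  rw [realDigamma_add_one hx]
  field_simp
  ring

/-! ### Convergence and partial sums. -/

theorem summable_funcSTerm {a : ℝ} (ha : 0 < a) :
    Summable fun i : ℕ => funcSTerm a (i + 1) := by
  have he : ∀ i : ℕ, funcSTerm a (i + 1) = digammaRemainder (((i + 1 : ℕ) : ℝ) / a) := by
    intro i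
    unfold funcSTerm digammaRemainder
    congr 2
    field_simp
  have hs : Summable fun i : ℕ => a ^ 2 / 8 * (1 / ((i + 1 : ℕ) : ℝ) ^ 2) :=
    ((summable_nat_add_iff 1).2
      (Real.summable_one_div_nat_pow (p := 2).2 one_lt_two)).mul_left _
  refine Summable.of_nonneg_of_le (fun i => ?_) (fun i => ?_) hs
  · rw [he]
    exact digammaRemainder_nonneg (by positivity)
  · rw [he]
    refine (digammaRemainder_le (by positivity)).trans_eq ?_
    field_simp

theorem funcSTerm_div {m n : ℕ} (hm : 0 < m) (hn : 0 < n) {k : ℕ} (hk : 0 < k) :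
    funcSTerm ((n : ℝ) / m) k = Real.log k - Real.log n - n / (2 * m) * (k : ℝ)⁻¹ -
      1 / m * ∑ j ∈ range m, realDigamma (k / n + j / m) := by
  have hm' : (0 : ℝ) < m := Nat.cast_pos.2 hm
  have hn' : (0 : ℝ) < n := Nat.cast_pos.2 hn
  have hk' : (0 : ℝ) < k := Nat.cast_pos.2 hk
  rw [sum_realDigamma_add_div hm (by positivity)]
  unfold funcSTerm
  rw [show (k : ℝ) / (n / m) = m * (k / n) by field_simp, Real.log_mul hm'.ne' (by positivity),
    Real.log_div hk'.ne' hn'.ne']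
  field_simp
  ring

theorem sum_range_funcSTerm_div {m n : ℕ} (hm : 0 < m) (hn : 0 < n) (K : ℕ) :
    ∑ i ∈ range K, funcSTerm ((n : ℝ) / m) (i + 1) =
      Real.log (K.factorial) - K * Real.log n - n / (2 * m) * (harmonic K : ℝ) -
        1 / m * ∑ i ∈ range K, ∑ j ∈ range m, realDigamma ((i + 1 : ℕ) / n + j / m) := by
  induction K with
  | zero => simp
  | succ K ih =>
    rw [sum_range_succ, ih, funcSTerm_div hm hn K.succ_pos, sum_range_succ, Nat.factorial_succ,
      harmonic_succ, Nat.cast_mul, Real.log_mul (by positivity) (by positivity)]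
    push_cast
    ring

/-- A block of n consecutive k raises the integer part N by one, so each residue r telescopes
separately. -/
theorem sum_range_mul_realDigamma {m n : ℕ} (hn : 0 < n) (N : ℕ) :
    ∑ i ∈ range (N * n), ∑ j ∈ range m, realDigamma ((i + 1 : ℕ) / n + j / m) =
      ∑ j ∈ range m, ∑ r ∈ range n, (digammaSum (N + (j / m + (r + 1 : ℕ) / n)) -
        digammaSum (j / m + (r + 1 : ℕ) / n)) := by
  have hn' : (0 : ℝ) < n := Nat.cast_pos.2 hn
  induction N with
  | zero => simp
  | succ N ih =>
    rw [Nat.succ_mul, sum_range_add, ih, sum_comm (s := range n), ← sum_add_distrib]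
    refine sum_congr rfl fun j _ => ?_
    rw [← sum_add_distrib]
    refine sum_congr rfl fun r _ => ?_
    have h1 : ((N * n + r + 1 : ℕ) : ℝ) / n + j / m = N + (j / m + (r + 1 : ℕ) / n) := by
      push_cast
      field_simp
      ring
    have h2 : ((N + 1 : ℕ) : ℝ) + (j / m + (r + 1 : ℕ) / n) =
        N + (j / m + (r + 1 : ℕ) / n) + 1 := by
      push_cast
      ring
    rw [h1, h2, digammaSum_add_one (by positivity)]
    ring

/-! ### Asymptotics and passage to the limit. -/

theorem tendsto_digammaSum_add_mul_log :
    Tendsto (fun x => digammaSum x - (x - 1) * Real.log x + x) atTop (𝓝 (-1 / 2)) := by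
  have hinv := tendsto_inv_atTop_zero (𝕜 := ℝ)
  have h1 : Tendsto (fun x => (x - 1) * digammaRemainder x) atTop (𝓝 0) := by
    refine squeeze_zero' (g := fun x => 1 / 8 * x⁻¹) ?_ ?_
      (by simpa only [mul_zero] using hinv.const_mul (1 / 8))
    · filter_upwards [eventually_ge_atTop 1] with x hx
      exact mul_nonneg (sub_nonneg.2 hx) (digammaRemainder_nonneg (by linarith))
    · filter_upwards [eventually_ge_atTop 1] with x hx
      have hx0 : 0 < x := by linarith
      calc (x - 1) * digammaRemainder x ≤ x * (1 / (8 * x ^ 2)) :=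
            mul_le_mul (by linarith) (digammaRemainder_le hx0) (digammaRemainder_nonneg hx0) hx0.le
        _ = 1 / 8 * x⁻¹ := by field_simp
  have h2 := ((hinv.const_mul (1 / 2)).sub h1).add_const (-1 / 2)
  rw [mul_zero, sub_zero, zero_add] at h2
  refine h2.congr' ?_
  filter_upwards [eventually_gt_atTop 0] with x hx
  unfold digammaSum digammaRemainder
  field_simp
  ring

/-- The comparison term is affine in c, so summing over the grid requires only the sum of the c. -/
theorem tendsto_digammaSum_natCast_add (c : ℝ) :
    Tendsto (fun N : ℕ => digammaSum (N + c) -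
      (N * Real.log N + (c - 1) * Real.log N - N)) atTop (𝓝 (-1 / 2)) := by
  have hx : Tendsto (fun N : ℕ => (N : ℝ) + c) atTop atTop :=
    tendsto_atTop_add_const_right _ _ tendsto_natCast_atTop_atTop
  have h1 := tendsto_digammaSum_add_mul_log.comp hx
  have h2 : Tendsto (fun N : ℕ => (N : ℝ) * Real.log (1 + c / N)) atTop (𝓝 c) :=
    (Real.tendsto_mul_log_one_add_div_atTop c).comp tendsto_natCast_atTop_atTop
  have h3 : Tendsto (fun N : ℕ => (c - 1) * Real.log (1 + c / N)) atTop (𝓝 0) := by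
    have ha : Tendsto (fun N : ℕ => 1 + c / (N : ℝ)) atTop (𝓝 (1 + 0)) :=
      (tendsto_const_nhds.div_atTop tendsto_natCast_atTop_atTop).const_add 1
    have hb := (ha.log (by norm_num)).const_mul (c - 1)
    simpa using hb
  have h4 := (h1.add (h2.add h3)).sub_const c
  rw [add_zero, add_sub_cancel_right] at h4
  refine h4.congr' ?_
  filter_upwards [hx.eventually_gt_atTop 0, eventually_gt_atTop 0] with N hN hN0
  have hN' : (0 : ℝ) < N := Nat.cast_pos.2 hN0
  have e : 1 + c / (N : ℝ) = (N + c) / N := by field_simp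
  rw [e, Real.log_div hN.ne' hN'.ne', Function.comp_apply]
  ring

theorem tendsto_log_factorial_sub :
    Tendsto (fun K : ℕ => Real.log K.factorial - (K * Real.log K - K + 1 / 2 * Real.log K)) atTop
      (𝓝 (1 / 2 * Real.log (2 * Real.pi))) := by
  have h := (Stirling.tendsto_stirlingSeq_sqrt_pi.log (by positivity)).add_const
    (1 / 2 * Real.log 2)
  have e : Real.log √Real.pi + 1 / 2 * Real.log 2 = 1 / 2 * Real.log (2 * Real.pi) := by
    rw [Real.log_sqrt Real.pi_pos.le, Real.log_mul two_ne_zero Real.pi_ne_zero]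
    ring
  rw [e] at h
  refine h.congr' ?_
  filter_upwards [eventually_gt_atTop 0] with K hK
  have hK' : (0 : ℝ) < K := Nat.cast_pos.2 hK
  rw [Stirling.log_stirlingSeq_formula, Real.log_mul two_ne_zero hK'.ne',
    Real.log_div hK'.ne' (Real.exp_ne_zero 1), Real.log_exp]
  ring

theorem funcS_div_eq {m n : ℕ} (hm : 0 < m) (hn : 0 < n) :
    funcS ((n : ℝ) / m) = 1 / 2 * Real.log (2 * Real.pi) + 1 / 2 * Real.log n -
      n / (2 * m) * (Real.log n + Real.eulerMascheroniConstant) + n / 2 +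
      1 / m * ∑ j ∈ range m, ∑ r ∈ range n, digammaSum (j / m + (r + 1 : ℕ) / n) := by
  have hm' : (0 : ℝ) < m := Nat.cast_pos.2 hm
  have hn' : (0 : ℝ) < n := Nat.cast_pos.2 hn
  -- Summability permits the subsequence K = Nn of complete blocks.
  have hK : Tendsto (fun N : ℕ => N * n) atTop atTop := tendsto_id.atTop_mul_const' hn
  have hS := (summable_funcSTerm (a := (n : ℝ) / m) (by positivity)).hasSum.tendsto_sum_nat.comp hK
  refine tendsto_nhds_unique hS ?_
  have h1 := tendsto_log_factorial_sub.comp hK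
  have h2 := (Real.tendsto_harmonic_sub_log.comp hK).const_mul ((n : ℝ) / (2 * m))
  have h3 := (tendsto_finsetSum (range m) fun j _ => tendsto_finsetSum (range n) fun r _ =>
    tendsto_digammaSum_natCast_add (j / m + (r + 1 : ℕ) / n)).const_mul (1 / (m : ℝ))
  have h4 := ((h1.sub h2).sub h3).add_const (1 / 2 * Real.log n - n / (2 * m) * Real.log n +
    1 / m * ∑ j ∈ range m, ∑ r ∈ range n, digammaSum (j / m + (r + 1 : ℕ) / n))
  convert h4.congr' ?_ using 2
  · simp only [sum_const, card_range, nsmul_eq_mul]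
    field_simp
    ring
  · filter_upwards [eventually_gt_atTop 0] with N hN
    have hN' : (0 : ℝ) < N := Nat.cast_pos.2 hN
    have hsub : ∀ A B : ℕ → ℕ → ℝ, ∑ j ∈ range m, ∑ r ∈ range n, (A j r - B j r) =
        ∑ j ∈ range m, ∑ r ∈ range n, A j r - ∑ j ∈ range m, ∑ r ∈ range n, B j r := by
      simp [sum_sub_distrib]
    have haff : ∀ (A L : ℝ) (C : ℕ → ℕ → ℝ), ∑ j ∈ range m, ∑ r ∈ range n, (A + C j r * L) =
        m * (n * A) + (∑ j ∈ range m, ∑ r ∈ range n, C j r) * L := by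
      simp [sum_add_distrib, sum_mul]
    have e : ∑ j ∈ range m, ∑ r ∈ range n, (N * Real.log N +
        (((j : ℝ) / m + (r + 1 : ℕ) / n) - 1) * Real.log N - N) =
        m * n * (N * Real.log N - N) + ((m : ℝ) - n) / 2 * Real.log N := by
      have e1 : ∀ j r : ℕ, (N : ℝ) * Real.log N +
          (((j : ℝ) / m + (r + 1 : ℕ) / n) - 1) * Real.log N - N =
          (N * Real.log N - N - Real.log N) +
            ((j : ℝ) / m + (r + 1 : ℕ) / n) * Real.log N := fun j r => by ring
      simp only [e1]
      rw [haff, sum_div_add_succ_div hm hn]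
      ring
    simp only [Function.comp_apply]
    rw [sum_range_funcSTerm_div hm hn, sum_range_mul_realDigamma hn, hsub, e, hsub, Nat.cast_mul,
      Real.log_mul hN'.ne' hn'.ne']
    field_simp
    ring

theorem mainTheorem4 (m n : ℕ) (hm : 0 < m) (hn : 0 < n) (hmn : Nat.Coprime m n) :
    Summable (fun i : ℕ => funcSTerm ((n : ℝ) / (m : ℝ)) (i + 1)) ∧
    funcS ((n : ℝ) / (m : ℝ)) =
      (Real.log (2 * Real.pi) - Real.eulerMascheroniConstant) / 2
        - 1 / (2 * (m : ℝ))
        - 1 / 2 * Real.log ((m : ℝ) / (n : ℝ))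
        + Real.pi / (2 * (n : ℝ)) *
            ∑ k ∈ Finset.Ico 1 n,
              ((n : ℝ) / 2 - (k : ℝ)) * Real.cot ((m : ℝ) * (k : ℝ) * Real.pi / (n : ℝ))
        + (n : ℝ) * Real.pi / (2 * (m : ℝ) ^ 2) *
            ∑ j ∈ Finset.Ico 1 m,
              ((m : ℝ) / 2 - (j : ℝ)) * Real.cot ((n : ℝ) * (j : ℝ) * Real.pi / (m : ℝ)) := by
  have hm' : (0 : ℝ) < m := Nat.cast_pos.2 hm
  have hn' : (0 : ℝ) < n := Nat.cast_pos.2 hn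
  refine ⟨summable_funcSTerm (by positivity), ?_⟩
  have hcot : ∀ {a : ℝ} (b : ℝ) (s : Finset ℕ), 0 < a →
      ∑ k ∈ s, (a / 2 - (k : ℝ)) * Real.cot (b * k * Real.pi / a) =
        -a * ∑ k ∈ s, ((k : ℝ) / a - 1 / 2) * Real.cot (Real.pi * (b * (k / a))) := by
    intro a b s ha
    rw [mul_sum]
    refine sum_congr rfl fun k _ => ?_
    rw [show b * k * Real.pi / a = Real.pi * (b * (k / a)) by ring]
    field_simp
    ring
  rw [hcot _ _ hn', hcot _ _ hm', funcS_div_eq hm hn, Real.log_div hm'.ne' hn'.ne']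
  unfold digammaSum
  rw [sum_sub_one_mul_realDigamma_sub hm hn hmn]
  field_simp
  ring
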